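/- **Setting.** For a matrix $B\in\mathbb R^{p\times m}$ let $\|B\|_F$ be the Frobenius norm, $\|B\|_{2,\infty}$ the largest Euclidean norm of a row, and $\|B\|_{2,\mathcal C}$ the number of distinct rows of $B$. Let $\langle\cdot,\cdot\rangle$ be the Frobenius inner product and $a\wedge b=\min(a,b)$. Let $X\in\mathbb R^{n\times p}$ and $B^*\in\mathbb R^{p\times m}$ be fixed, let $Y$ be random data, and let $l_0(\eta;Y)$ be a loss, measurable in $Y$, which for every value of $Y$ is differentiable and $\mu$-strongly convex in $\eta\in\mathbb R^{n\times m}$, $\mu>0$: $$l_0(\eta';Y)\ge l_0(\eta;Y)+\langle\nabla l_0(\eta;Y),\eta'-\eta\rangle+\tfrac{\mu}{2}\|\eta'-\eta\|_F^2\qquad\text{for all }\eta,\eta'.$$ Put $\mathbf D_{l_0}(\alpha,\beta)=l_0(\alpha;Y)-l_0(\beta;Y)-\langle\nabla l_0(\beta;Y),\alpha-\beta\rangle$. Assume that the effective noise $E=-\nabla l_0(XB^*;Y)$ is sub-Gaussian with mean zero and scale bounded by $\sigma\ge0$, that is, $\mathbb E E=0$ and $\|\langle E,A\rangle\|_{\psi_2}\le\sigma\|A\|_F$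 for all $A\in\mathbb R^{n\times m}$, where $\|Z\|_{\psi_2}=\inf\{t>0:\mathbb E\exp(Z^2/t^2)\le2\}$. Let $1\le q\le p$ and $r\ge0$ be integers, and let $\hat B$ (a random matrix) be a global minimizer of $B\mapsto l_0(XB;Y)$ over all $B\in\mathbb R^{p\times m}$ with $\operatorname{rank}(B)\le r$ and $\|B\|_{2,\mathcal C}\le q$. **Corollary 1.** There are universal constants $C_1,c_0,c,C>0$ such that the following holds in every such setting. (i) For every $B\in\mathbb R^{p\times m}$ with $\operatorname{rank}(B)\le r$ and $\|B\|_{2,\mathcal C}\le q$, $$\mathbb E\,\mathbf D_{l_0}(X\hat B,XB^*)\le C_1\Big[\mathbb E\,\mathbf D_{l_0}(XB,XB^*)+\frac{\sigma^2}{\mu}\big\{(q\wedge\operatorname{rank}X+m)\,r+(p-q)\log q+1\big\}\Big].$$ (ii) Let $r^*=\operatorname{rank}(B^*)$ and $q^*=\|B^*\|_{2,\mathcal C}$. Suppose that $q^*>1$, that $r=\vartheta r^*$ and $q=\vartheta q^*$ for some real $\vartheta\ge1$, and that for some $\delta>0$ $$\frac1n\|XB\|_F^2\ge\delta\,\|B\|_{2,\infty}^2\qquad\text{for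 all }B\in\mathbb R^{p\times m}\text{ with }\operatorname{rank}(B)\le(1+\vartheta)r^*,\ \|B\|_{2,\mathcal C}\le\vartheta q^{*2}.$$ Then with probability at least $1-C\exp\{-c(m+\operatorname{rank}X)\}$ $$\|\hat B-B^*\|_{2,\infty}^2\le R:=\frac{c_0\vartheta^2\sigma^2}{n\delta\mu^2}\big\{(q^*\wedge\operatorname{rank}X+m)\,r^*+(p-q^*)\log q^*\big\}.$$ (iii) If, in addition to the assumptions of (ii), any two distinct rows $b^*_j\ne b^*_k$ of $B^*$ satisfy $\|b_j^*-b_k^*\|_2^2>4R$, then with probability at least $1-C\exp\{-c(m+\operatorname{rank}X)\}$ the row clusters of $\hat B$ refine those of $B^*$ (equal rows $\hat b_j=\hat b_k$ of $\hat B$ have $b^*_j=b^*_k$), and they coincide with those of $B^*$ if $q=q^*$. -/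

import Mathlib

open MeasureTheory
open scoped ENNReal

noncomputable section

namespace CRL

/-- Frobenius inner product `⟨A, B⟩`. -/
def frobInner {n m : ℕ} (A B : Matrix (Fin n) (Fin m) ℝ) : ℝ :=
  ∑ i, ∑ j, A i j * B i j

/-- Squared Frobenius norm `‖A‖_F²`. -/
def frobSq {n m : ℕ} (A : Matrix (Fin n) (Fin m) ℝ) : ℝ :=
  ∑ i, ∑ j, A i j ^ 2

/-- `‖A‖_{2,∞}`: the largest Euclidean norm of a row of `A`. -/
def twoInfNorm {p m : ℕ} (A : Matrix (Fin p) (Fin m) ℝ) : ℝ :=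
  ⨆ j : Fin p, Real.sqrt (∑ l, A j l ^ 2)

/-- `‖B‖_{2,𝒞}`: the number of distinct rows of `B`. -/
def numRows {p m : ℕ} (B : Matrix (Fin p) (Fin m) ℝ) : ℕ :=
  (Set.range fun j : Fin p => B j).ncard

/-- The matrices of rank at most `r` with at most `q` distinct rows. -/
def feasible (p m q r : ℕ) : Set (Matrix (Fin p) (Fin m) ℝ) :=
  {B | B.rank ≤ r ∧ numRows B ≤ q}

/-- The gradient of `f` at `η`, as the matrix of partial derivatives. -/
def grad {n m : ℕ} (f : Matrix (Fin n) (Fin m) ℝ → ℝ) (η : Matrix (Fin n) (Fin m) ℝ) :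
    Matrix (Fin n) (Fin m) ℝ :=
  Matrix.of fun i j => fderiv ℝ f η (Matrix.single i j 1)

/-- The Bregman function `f(α) - f(β) - ⟨∇f(β), α - β⟩`. -/
def bregman {n m : ℕ} (f : Matrix (Fin n) (Fin m) ℝ → ℝ) (α β : Matrix (Fin n) (Fin m) ℝ) : ℝ :=
  f α - f β - frobInner (grad f β) (α - β)

/-- `f` is differentiable and `μ`-strongly convex. -/
def StronglyConvex {n m : ℕ} (μ : ℝ) (f : Matrix (Fin n) (Fin m) ℝ → ℝ) : Prop :=
  Differentiable ℝ f ∧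
    ∀ η η' : Matrix (Fin n) (Fin m) ℝ,
      f η + frobInner (grad f η) (η' - η) + μ * frobSq (η' - η) / 2 ≤ f η'

/-- The norm `‖Z‖_{ψ₂} = inf {t > 0 : 𝔼 exp((Z/t)²) ≤ 2}`, with value `∞` if there is
no such `t`. -/
def psi2Norm {Ω : Type*} [MeasurableSpace Ω] (P : Measure Ω) (Z : Ω → ℝ) : ℝ≥0∞ :=
  ⨅ (t : ℝ) (_ : 0 < t) (_ : ∫⁻ ω, ENNReal.ofReal (Real.exp ((Z ω / t) ^ 2)) ∂P ≤ 2),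
    ENNReal.ofReal t

/-- `vec(E)` is a sub-Gaussian random vector with mean zero and scale bounded by `σ`. -/
def SubGaussianMatrix {Ω : Type*} [MeasurableSpace Ω] {n m : ℕ} (P : Measure Ω)
    (E : Ω → Matrix (Fin n) (Fin m) ℝ) (σ : ℝ) : Prop :=
  (∀ i j, AEMeasurable (fun ω => E ω i j) P) ∧
  (∀ i j, ∫ ω, E ω i j ∂P = 0) ∧
  ∀ A : Matrix (Fin n) (Fin m) ℝ,
    psi2Norm P (fun ω => frobInner (E ω) A) ≤ ENNReal.ofReal (σ * Real.sqrt (frobSq A))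

/-- The complexity `(q ∧ rank X + m) r + (p - q) log q`. -/
def complexity {n p : ℕ} (m : ℕ) (X : Matrix (Fin n) (Fin p) ℝ) (q r : ℕ) : ℝ :=
  (((min q X.rank : ℕ) : ℝ) + m) * r + ((p : ℝ) - q) * Real.log q

/-- `B` is a global minimizer of `B ↦ f(X B)` over the matrices of rank at most `r` with at most
`q` distinct rows. -/
def IsGlobalCRL {n p m : ℕ} (X : Matrix (Fin n) (Fin p) ℝ) (f : Matrix (Fin n) (Fin m) ℝ → ℝ)
    (q r : ℕ) (B : Matrix (Fin p) (Fin m) ℝ) : Prop :=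
  B ∈ feasible p m q r ∧ IsMinOn (fun B' => f (X * B')) (feasible p m q r) B

/-- The right-hand side `c₀ ϑ² σ² / (n δ μ²) · {(q* ∧ rank X + m) r* + (p - q*) log q*}`,
with `r* = rank B*` and `q* = ‖B*‖_{2,𝒞}`. -/
def estBound {n p m : ℕ} (X : Matrix (Fin n) (Fin p) ℝ) (Bstar : Matrix (Fin p) (Fin m) ℝ)
    (c₀ ϑ σ δ μ : ℝ) : ℝ :=
  c₀ * ϑ ^ 2 * σ ^ 2 / (n * δ * μ ^ 2) * complexity m X (numRows Bstar) Bstar.rank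

end CRL

end

universe u v

open CRL

/-! Optimality of `Bhat` against a feasible `B` bounds one Bregman error by the other plus the noise
term `⟨E, X Bhat - X B⟩`. A Cauchy–Schwarz split leaves a multiple of `‖X Bhat - X B‖_F²`, absorbed
by strong convexity, and the square of the noise against a unit-size direction. What remains is to
control that noise uniformly over directions.

The direction is random, so it is replaced by a member of a fixed finite set of at most `exp (8 ·
complexity)` matrices (`exists_feasible_net`). Two counts give this size: the row-merging patterns
number `exp (O((p - q) log q))` (`exists_clusterMaps`), and for a fixed pattern the differences have
rank at most `2r` and columns in a space of dimension at most `2 (q ∧ rank X)`, so they have a small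
net (`exists_lowRank_net`).

Averaging the maximum of the squared noise over this set gives the oracle inequality. A union bound
with `B = Bstar` gives a prediction bound with high probability, which the restricted eigenvalue
condition turns into a row-wise bound. Row separation then forces cluster refinement, and counting
clusters gives equality. -/

namespace CRL

/-! ### Nets of unit balls and the suprema of linear and bilinear forms -/

/-- The closed unit ball of a finite-dimensional normed space has a `1/2`-net with at most
`5 ^ dim` points. -/
lemma exists_half_net (V : Type*) [NormedAddCommGroup V] [NormedSpace ℝ V]
    [FiniteDimensional ℝ V] :
    ∃ s : Finset V, s.card ≤ 5 ^ Module.finrank ℝ V ∧ (∀ x ∈ s, ‖x‖ ≤ 1) ∧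
      ∀ x : V, ‖x‖ ≤ 1 → ∃ y ∈ s, ‖x - y‖ ≤ 1 / 2 := by
  classical
  let Sep : Finset V → Prop := fun s =>
    (∀ x ∈ s, ‖x‖ ≤ 1) ∧ ∀ x ∈ s, ∀ y ∈ s, x ≠ y → 1 / 2 ≤ ‖x - y‖
  have hcard : ∀ s, Sep s → s.card ≤ 5 ^ Module.finrank ℝ V := by
    intro s hs
    -- Doubling gives a `1`-separated set in the ball of radius `2`, the normalization of the
    -- Besicovitch packing bound `5 ^ dim`.
    have hinj : Function.Injective fun x : V => (2 : ℝ) • x :=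
      smul_right_injective V (two_ne_zero : (2 : ℝ) ≠ 0)
    rw [← Finset.card_image_of_injective s hinj]
    apply Besicovitch.card_le_of_separated
    · intro c hc
      obtain ⟨x, hx, rfl⟩ := Finset.mem_image.1 hc
      have := hs.1 x hx
      simp only [norm_smul, Real.norm_ofNat]
      linarith
    · intro c hc d hd hcd
      obtain ⟨x, hx, rfl⟩ := Finset.mem_image.1 hc
      obtain ⟨y, hy, rfl⟩ := Finset.mem_image.1 hd
      have := hs.2 x hx y hy (by rintro rfl; exact hcd rfl)
      simp only [← smul_sub, norm_smul, Real.norm_ofNat]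
      linarith
  -- A separated set of largest cardinality is a net: an uncovered point could be added to it.
  let N := Nat.findGreatest (fun N => ∃ s, Sep s ∧ s.card = N) (5 ^ Module.finrank ℝ V)
  obtain ⟨s, hs, hsN⟩ : ∃ s, Sep s ∧ s.card = N :=
    Nat.findGreatest_spec (P := fun N => ∃ s, Sep s ∧ s.card = N) (Nat.zero_le _)
      ⟨∅, ⟨by simp, by simp⟩, rfl⟩
  refine ⟨s, hcard s hs, hs.1, fun x hx => ?_⟩
  by_contra! hfar
  have hxs : x ∉ s := fun h => by
    have := hfar x h
    simp at this
    linarith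
  have hins : Sep (insert x s) := by
    constructor
    · intro y hy
      rcases Finset.mem_insert.1 hy with rfl | hy
      exacts [hx, hs.1 y hy]
    · intro y hy z hz hyz
      rcases Finset.mem_insert.1 hy with rfl | hys <;>
        rcases Finset.mem_insert.1 hz with rfl | hzs
      · exact absurd rfl hyz
      · exact (hfar z hzs).le
      · rw [norm_sub_rev]; exact (hfar y hys).le
      · exact hs.2 y hys z hzs hyz
  have hle : (insert x s).card ≤ N := Nat.le_findGreatest (hcard _ hins) ⟨_, hins, rfl⟩
  rw [Finset.card_insert_of_notMem hxs] at hle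
  omega

/-- A linear functional is controlled on the unit ball by its values on a `1/2`-net. -/
lemma le_two_mul_of_half_net {V : Type*} [NormedAddCommGroup V] [NormedSpace ℝ V]
    [FiniteDimensional ℝ V] {s : Finset V}
    (hs : ∀ x : V, ‖x‖ ≤ 1 → ∃ y ∈ s, ‖x - y‖ ≤ 1 / 2) (φ : V →ₗ[ℝ] ℝ) {x : V} (hx : ‖x‖ ≤ 1) :
    ∃ y ∈ s, φ x ≤ 2 * φ y := by
  have hφ : Continuous φ := φ.continuous_of_finiteDimensional
  obtain ⟨x₀, hx₀, hmax⟩ := (isCompact_closedBall (0 : V) 1).exists_isMaxOn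
    ⟨0, by simp⟩ hφ.continuousOn
  have hmax' : ∀ z : V, ‖z‖ ≤ 1 → φ z ≤ φ x₀ := fun z hz => hmax (by simpa using hz)
  obtain ⟨y, hy, hxy⟩ := hs x₀ (by simpa using hx₀)
  refine ⟨y, hy, ?_⟩
  -- At the maximizer, `φ (x₀ - y) ≤ φ x₀ / 2`, hence `φ x₀ ≤ 2 φ y`.
  have h1 := hmax' ((2 : ℝ) • (x₀ - y)) (by
    rw [norm_smul, Real.norm_ofNat]; linarith)
  rw [map_smul, map_sub, smul_eq_mul] at h1
  have h2 := hmax' x hx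
  linarith

/-- A bilinear form is controlled on a product of unit balls by its values on `1/2`-nets. -/
lemma le_four_mul_of_half_net {V W : Type*} [NormedAddCommGroup V] [NormedSpace ℝ V]
    [FiniteDimensional ℝ V] [NormedAddCommGroup W] [NormedSpace ℝ W] [FiniteDimensional ℝ W]
    {s : Finset V} {t : Finset W}
    (hs : ∀ x : V, ‖x‖ ≤ 1 → ∃ y ∈ s, ‖x - y‖ ≤ 1 / 2)
    (ht : ∀ x : W, ‖x‖ ≤ 1 → ∃ y ∈ t, ‖x - y‖ ≤ 1 / 2)
    (φ : V →ₗ[ℝ] W →ₗ[ℝ] ℝ) {x : V} {y : W} (hx : ‖x‖ ≤ 1) (hy : ‖y‖ ≤ 1) :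
    ∃ x' ∈ s, ∃ y' ∈ t, φ x y ≤ 4 * φ x' y' := by
  obtain ⟨x', hx', h1⟩ := le_two_mul_of_half_net hs (φ.flip y) hx
  obtain ⟨y', hy', h2⟩ := le_two_mul_of_half_net ht (φ x') hy
  refine ⟨x', hx', y', hy', ?_⟩
  simp only [LinearMap.flip_apply] at h1
  linarith

/-- A Euclidean space of dimension at most `k` embeds isometrically into `ℝᵏ`. -/
lemma exists_linearIsometry_euclideanSpace {V : Type*} [NormedAddCommGroup V]
    [InnerProductSpace ℝ V] [FiniteDimensional ℝ V] {k : ℕ} (h : Module.finrank ℝ V ≤ k) :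
    Nonempty (V →ₗᵢ[ℝ] EuclideanSpace ℝ (Fin k)) := by
  let b := stdOrthonormalBasis ℝ V
  let f : V →ₗ[ℝ] EuclideanSpace ℝ (Fin k) :=
    b.toBasis.constr ℝ fun i => EuclideanSpace.basisFun (Fin k) ℝ (Fin.castLE h i)
  refine ⟨f.isometryOfOrthonormal (v := b.toBasis) (by simp) ?_⟩
  have : f ∘ b.toBasis = fun i => EuclideanSpace.basisFun (Fin k) ℝ (Fin.castLE h i) := by
    funext i
    simp [f]
  rw [this]
  exact (EuclideanSpace.basisFun (Fin k) ℝ).orthonormal.comp _ (Fin.castLE_injective h)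

/-! ### Frobenius geometry and nets of low-rank matrices -/

/-- The columns of a matrix, as vectors of a Euclidean space. -/
def colVec {n m : ℕ} (A : Matrix (Fin n) (Fin m) ℝ) (l : Fin m) : EuclideanSpace ℝ (Fin n) :=
  WithLp.toLp 2 fun i => A i l

lemma frobInner_eq_sum_inner {n m : ℕ} (A B : Matrix (Fin n) (Fin m) ℝ) :
    frobInner A B = ∑ l, inner ℝ (colVec A l) (colVec B l) := by
  unfold frobInner
  rw [Finset.sum_comm]
  simp [colVec, PiLp.inner_apply, mul_comm]

lemma frobSq_eq_sum_norm {n m : ℕ} (A : Matrix (Fin n) (Fin m) ℝ) :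
    frobSq A = ∑ l, ‖colVec A l‖ ^ 2 := by
  unfold frobSq
  rw [Finset.sum_comm]
  simp [colVec, EuclideanSpace.norm_sq_eq]

lemma frobSq_nonneg {n m : ℕ} (A : Matrix (Fin n) (Fin m) ℝ) : 0 ≤ frobSq A :=
  Finset.sum_nonneg fun _ _ => Finset.sum_nonneg fun _ _ => sq_nonneg _

lemma frobSq_eq_zero {n m : ℕ} {A : Matrix (Fin n) (Fin m) ℝ} (h : frobSq A = 0) : A = 0 := by
  ext i j
  have h1 := (Finset.sum_eq_zero_iff_of_nonneg
    (fun i _ => Finset.sum_nonneg fun j _ => sq_nonneg (A i j))).1 h i (Finset.mem_univ _)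
  have h2 := (Finset.sum_eq_zero_iff_of_nonneg (fun j _ => sq_nonneg (A i j))).1 h1 j
    (Finset.mem_univ _)
  simpa using h2

lemma finrank_span_colVec {n m : ℕ} (A : Matrix (Fin n) (Fin m) ℝ) :
    Module.finrank ℝ (Submodule.span ℝ (Set.range (colVec A))) = A.rank := by
  rw [Matrix.rank_eq_finrank_span_cols]
  have : Submodule.span ℝ (Set.range (colVec A)) =
      (Submodule.span ℝ (Set.range A.col)).map
        ((WithLp.linearEquiv 2 ℝ (Fin n → ℝ)).symm : (Fin n → ℝ) →ₗ[ℝ] _) := by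
    rw [Submodule.map_span, ← Set.range_comp]
    rfl
  rw [this]
  exact LinearEquiv.finrank_map_eq (WithLp.linearEquiv 2 ℝ (Fin n → ℝ)).symm _

/-- The matrices of rank at most `k` with columns in `W`, measured against an arbitrary matrix,
are controlled by finitely many matrices in the unit ball. -/
lemma exists_lowRank_net {n : ℕ} (W : Submodule ℝ (EuclideanSpace ℝ (Fin n))) (m k : ℕ) :
    ∃ s : Finset (Matrix (Fin n) (Fin m) ℝ), s.card ≤ 5 ^ (k * (Module.finrank ℝ W + m)) ∧
      (∀ A ∈ s, frobSq A ≤ 1) ∧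
      ∀ A : Matrix (Fin n) (Fin m) ℝ, A.rank ≤ k → (∀ l, colVec A l ∈ W) →
        ∀ E : Matrix (Fin n) (Fin m) ℝ,
          ∃ A' ∈ s, frobInner E A ≤ 4 * √(frobSq A) * frobInner E A' := by
  classical
  -- A rank-`k` matrix with columns in `W` factors through `ℝᵏ`. The left factor is measured in
  -- operator norm and the right one in Frobenius norm, so products of net points stay in the
  -- Frobenius unit ball; the dimensions add up to `k (dim W + m)`.
  let V₁ := EuclideanSpace ℝ (Fin k) →L[ℝ] W
  let V₂ := PiLp 2 fun _ : Fin m => EuclideanSpace ℝ (Fin k)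
  have hV₁ : Module.finrank ℝ V₁ = k * Module.finrank ℝ W := by
    rw [← (LinearMap.toContinuousLinearMap (𝕜 := ℝ) (E := EuclideanSpace ℝ (Fin k))
      (F' := W)).finrank_eq, Module.finrank_linearMap, finrank_euclideanSpace_fin]
  have hV₂ : Module.finrank ℝ V₂ = k * m := by
    rw [(WithLp.linearEquiv 2 ℝ (Fin m → EuclideanSpace ℝ (Fin k))).finrank_eq,
      Module.finrank_pi_fintype]
    simp [mul_comm]
  have : FiniteDimensional ℝ V₁ :=
    (LinearMap.toContinuousLinearMap (𝕜 := ℝ) (E := EuclideanSpace ℝ (Fin k))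
      (F' := W)).finiteDimensional
  have : FiniteDimensional ℝ V₂ :=
    (WithLp.linearEquiv 2 ℝ (Fin m → EuclideanSpace ℝ (Fin k))).symm.finiteDimensional
  obtain ⟨s, hs, hs1, hsn⟩ := exists_half_net V₁
  obtain ⟨t, ht, ht1, htn⟩ := exists_half_net V₂
  let M : V₁ → V₂ → Matrix (Fin n) (Fin m) ℝ := fun G H =>
    Matrix.of fun i l => (G (H l) : EuclideanSpace ℝ (Fin n)) i
  have hMcol : ∀ G H l, colVec (M G H) l = (G (H l) : EuclideanSpace ℝ (Fin n)) :=
    fun G H l => rfl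
  refine ⟨(s ×ˢ t).image fun x => M x.1 x.2, ?_, ?_, ?_⟩
  · calc _ ≤ (s ×ˢ t).card := Finset.card_image_le
      _ = s.card * t.card := Finset.card_product _ _
      _ ≤ 5 ^ (k * Module.finrank ℝ W) * 5 ^ (k * m) := by
        rw [hV₁] at hs; rw [hV₂] at ht; gcongr
      _ = _ := by rw [← pow_add, ← mul_add]
  · intro A hA
    obtain ⟨⟨G, H⟩, hGH, rfl⟩ := Finset.mem_image.1 hA
    obtain ⟨hG, hH⟩ := Finset.mem_product.1 hGH
    have hG1 : ‖G‖ ≤ 1 := hs1 G hG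
    have hH1 : ‖H‖ ^ 2 ≤ 1 := by
      have : ‖H‖ ≤ 1 := ht1 H hH
      exact pow_le_one₀ (norm_nonneg _) this
    rw [PiLp.norm_sq_eq_of_L2] at hH1
    rw [frobSq_eq_sum_norm]
    refine le_trans (Finset.sum_le_sum fun l _ => ?_) hH1
    rw [hMcol]
    gcongr
    calc ‖(G (H l) : EuclideanSpace ℝ (Fin n))‖ = ‖G (H l)‖ := rfl
      _ ≤ ‖G‖ * ‖H l‖ := G.le_opNorm _
      _ ≤ 1 * ‖H l‖ := by gcongr
      _ = ‖H l‖ := one_mul _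
  · intro A hr hW E
    have hadd : ∀ (H H' : V₂) l, (H + H') l = H l + H' l := fun _ _ _ => rfl
    have hsmul : ∀ (c : ℝ) (H : V₂) l, (c • H) l = c • H l := fun _ _ _ => rfl
    let φ : V₁ →ₗ[ℝ] V₂ →ₗ[ℝ] ℝ := LinearMap.mk₂ ℝ
      (fun G H => ∑ l, inner ℝ (colVec E l) (G (H l) : EuclideanSpace ℝ (Fin n)))
      (by intro G G' H; simp [inner_add_right, Finset.sum_add_distrib])
      (by intro c G H; simp [inner_smul_right, Finset.mul_sum])
      (by intro G H H'; simp [hadd, inner_add_right, Finset.sum_add_distrib])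
      (by intro c G H; simp [hsmul, inner_smul_right, Finset.mul_sum])
    have hφ : ∀ G H, φ G H = frobInner E (M G H) := fun G H => by
      rw [frobInner_eq_sum_inner]; rfl
    have hcover : ∀ G : V₁, ∀ H : V₂, ‖G‖ ≤ 1 → ‖H‖ ≤ 1 →
        ∃ A' ∈ (s ×ˢ t).image fun x => M x.1 x.2, φ G H ≤ 4 * frobInner E A' := by
      intro G H hG hH
      obtain ⟨G', hG', H', hH', hle⟩ := le_four_mul_of_half_net hsn htn φ hG hH
      exact ⟨M G' H', Finset.mem_image.2 ⟨(G', H'), Finset.mk_mem_product hG' hH', rfl⟩,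
        by rwa [hφ G' H'] at hle⟩
    rcases eq_or_ne (frobSq A) 0 with h0 | h0
    · obtain ⟨A', hA', -⟩ := hcover 0 0 ((norm_zero (E := V₁)).trans_le zero_le_one)
        ((norm_zero (E := V₂)).trans_le zero_le_one)
      refine ⟨A', hA', ?_⟩
      simp [frobSq_eq_zero h0, frobInner, frobSq]
    · have hpos : 0 < √(frobSq A) := Real.sqrt_pos.2 (lt_of_le_of_ne (frobSq_nonneg A) h0.symm)
      let V := Submodule.span ℝ (Set.range (colVec A))
      have hVW : V ≤ W := Submodule.span_le.2 (by rintro _ ⟨l, rfl⟩; exact hW l)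
      obtain ⟨ι⟩ := exists_linearIsometry_euclideanSpace (V := V) (k := k)
        (by rw [finrank_span_colVec]; exact hr)
      -- With `ι` an isometry from the column span into `ℝᵏ`, the adjoint undoes `ι`, so `G`
      -- recovers the columns of `A` from their coordinates, which `H` lists after normalization.
      let G : V₁ := (LinearMap.toContinuousLinearMap (Submodule.inclusion hVW)).comp
        (ContinuousLinearMap.adjoint ι.toContinuousLinearMap)
      let a : Fin m → V := fun l => ⟨colVec A l, Submodule.subset_span ⟨l, rfl⟩⟩
      let H : V₂ := (√(frobSq A))⁻¹ • WithLp.toLp 2 fun l => ι (a l)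
      have hG : ‖G‖ ≤ 1 := by
        refine ContinuousLinearMap.opNorm_le_bound _ zero_le_one fun x => ?_
        calc ‖G x‖ = ‖ContinuousLinearMap.adjoint ι.toContinuousLinearMap x‖ := rfl
          _ ≤ ‖ContinuousLinearMap.adjoint ι.toContinuousLinearMap‖ * ‖x‖ :=
            ContinuousLinearMap.le_opNorm _ _
          _ ≤ 1 * ‖x‖ := by
            gcongr
            rw [LinearIsometryEquiv.norm_map]
            exact ι.norm_toContinuousLinearMap_le
      have hH : ‖H‖ ≤ 1 := by
        have h1 : ‖(WithLp.toLp 2 fun l => ι (a l) : V₂)‖ = √(frobSq A) := by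
          rw [PiLp.norm_eq_of_L2, frobSq_eq_sum_norm]
          congr 1
          refine Finset.sum_congr rfl fun l _ => ?_
          simp [a]
        rw [norm_smul, h1, norm_inv, Real.norm_of_nonneg hpos.le, inv_mul_cancel₀ hpos.ne']
      have hGH : φ G H = (√(frobSq A))⁻¹ * frobInner E A := by
        have h1 : φ G H = (√(frobSq A))⁻¹ * φ G (WithLp.toLp 2 fun l => ι (a l)) := by
          simp [H]
        rw [h1, frobInner_eq_sum_inner]
        congr 1
        rw [LinearMap.mk₂_apply]
        refine Finset.sum_congr rfl fun l _ => ?_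
        congr 1
        have hadj : ContinuousLinearMap.adjoint ι.toContinuousLinearMap (ι (a l)) = a l := by
          refine ext_inner_right ℝ fun v => ?_
          rw [ContinuousLinearMap.adjoint_inner_left]
          exact ι.inner_map_map _ _
        have : G (ι (a l)) = Submodule.inclusion hVW (a l) :=
          congrArg (Submodule.inclusion hVW) hadj
        rw [this]
        rfl
      obtain ⟨A', hA', hle⟩ := hcover G H hG hH
      refine ⟨A', hA', ?_⟩
      rw [hGH, inv_mul_le_iff₀ hpos] at hle
      linarith

/-! ### Counting the row-merging patterns -/

/-- Label the points with `q` colours and send each point to a chosen point of its colour. The count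
`q ^ p` is good enough here because `p ≤ 2 (p - q)`. -/
lemma exists_clusterMaps_of_two_mul_le {p q : ℕ} (hq : 1 ≤ q) (h : 2 * q ≤ p) :
    ∃ 𝓕 : Finset (Fin p → Fin p), 𝓕.card ≤ q ^ p ∧
      (∀ F ∈ 𝓕, (Finset.univ.image F).card ≤ q) ∧
      ∀ {α : Type} (b : Fin p → α), (Set.range b).ncard ≤ q → ∃ F ∈ 𝓕, ∀ j, b (F j) = b j := by
  classical
  have : Nonempty (Fin p) := ⟨⟨0, by omega⟩⟩
  refine ⟨Finset.univ.image fun f : Fin p → Fin q => Function.invFun f ∘ f, ?_, ?_, ?_⟩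
  · refine Finset.card_image_le.trans ?_
    simp
  · intro F hF
    obtain ⟨f, -, rfl⟩ := Finset.mem_image.1 hF
    calc (Finset.univ.image (Function.invFun f ∘ f)).card
        ≤ (Finset.univ.image (Function.invFun f)).card := by
          apply Finset.card_le_card
          rw [← Finset.image_image]
          exact Finset.image_subset_image (Finset.subset_univ _)
      _ ≤ q := Finset.card_image_le.trans (by simp)
  · intro α b hb
    have hcard : Nat.card (Set.range b) ≤ Nat.card (Fin q) := by
      rw [Nat.card_eq_fintype_card (α := Fin q), Fintype.card_fin]
      exact hb
    obtain ⟨e⟩ : Nonempty (Set.range b ↪ Fin q) := by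
      have := Fintype.ofFinite (Set.range b)
      rw [Nat.card_eq_fintype_card, Nat.card_eq_fintype_card] at hcard
      exact Function.Embedding.nonempty_of_card_le hcard
    let f : Fin p → Fin q := fun j => e ⟨b j, j, rfl⟩
    refine ⟨Function.invFun f ∘ f, Finset.mem_image_of_mem _ (Finset.mem_univ f), fun j => ?_⟩
    have h1 : f (Function.invFun f (f j)) = f j := Function.invFun_eq ⟨j, rfl⟩
    exact congrArg Subtype.val (e.injective h1)

/-- When `q` is close to `p`, few points need to move: enlarge a set of representatives to `q`
points, fix these, and record where the other `p - q` go. A table of `p - q` (source, target) pairs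
describes the map. -/
lemma exists_clusterMaps_of_le {p q : ℕ} (hq : 1 ≤ q) (h : q ≤ p) :
    ∃ 𝓕 : Finset (Fin p → Fin p), 𝓕.card ≤ (p * p) ^ (p - q) ∧
      (∀ F ∈ 𝓕, (Finset.univ.image F).card ≤ q) ∧
      ∀ {α : Type} (b : Fin p → α), (Set.range b).ncard ≤ q → ∃ F ∈ 𝓕, ∀ j, b (F j) = b j := by
  classical
  have : Nonempty (Fin p) := ⟨⟨0, by omega⟩⟩
  let upd : (Fin (p - q) → Fin p × Fin p) → Fin p → Fin p := fun g x =>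
    if hx : ∃ i, (g i).1 = x then (g hx.choose).2 else x
  -- An arbitrary table may repeat sources and so take more than `q` values; the filter discards
  -- such maps.
  refine ⟨(Finset.univ.image upd).filter fun F => (Finset.univ.image F).card ≤ q, ?_, ?_, ?_⟩
  · refine (Finset.card_filter_le _ _).trans (Finset.card_image_le.trans ?_)
    simp
  · intro F hF
    exact (Finset.mem_filter.1 hF).2
  · intro α b hb
    let rep : Fin p → Fin p := fun j => Function.invFun b (b j)
    have hrep : ∀ j, b (rep j) = b j := fun j => Function.invFun_eq ⟨j, rfl⟩
    have hS₀ : (Finset.univ.image rep).card ≤ q := by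
      have h1 : Finset.univ.image rep = (Finset.univ.image b).image (Function.invFun b) := by
        rw [Finset.image_image]; rfl
      rw [h1]
      refine Finset.card_image_le.trans ?_
      rwa [← Set.ncard_coe_finset, Finset.coe_image, Finset.coe_univ, Set.image_univ]
    obtain ⟨S, hS₀S, hS⟩ := Finset.exists_superset_card_eq hS₀ (by simpa using h)
    have hSc : Sᶜ.card = p - q := by rw [Finset.card_compl, hS, Fintype.card_fin]
    let e := Sᶜ.equivFinOfCardEq hSc
    let g : Fin (p - q) → Fin p × Fin p := fun i => ((e.symm i : Fin p), rep (e.symm i))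
    have hin : ∀ x, x ∈ S → upd g x = x := by
      intro x hx
      refine dif_neg ?_
      rintro ⟨i, rfl⟩
      exact Finset.mem_compl.1 (e.symm i).2 hx
    have hout : ∀ x, x ∉ S → upd g x = rep x := by
      intro x hx
      have hex : ∃ i, (g i).1 = x :=
        ⟨e ⟨x, Finset.mem_compl.2 hx⟩, by simp [g]⟩
      have h1 : upd g x = (g hex.choose).2 := dif_pos hex
      have h2 : (g hex.choose).1 = x := hex.choose_spec
      rw [h1]
      exact congrArg rep h2
    refine ⟨upd g, Finset.mem_filter.2 ⟨Finset.mem_image_of_mem _ (Finset.mem_univ g), ?_⟩, ?_⟩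
    · rw [← hS]
      apply Finset.card_le_card
      intro y hy
      obtain ⟨x, -, rfl⟩ := Finset.mem_image.1 hy
      by_cases hx : x ∈ S
      · rwa [hin x hx]
      · rw [hout x hx]
        exact hS₀S (Finset.mem_image_of_mem _ (Finset.mem_univ x))
    · intro x
      by_cases hx : x ∈ S
      · rw [hin x hx]
      · rw [hout x hx, hrep]

/-- The partitions of `p` points into at most `q` classes are represented by a family of
`exp (4 (p - q) log q)` maps with at most `q` values. -/
lemma exists_clusterMaps {p q : ℕ} (hq : 1 ≤ q) (h : q ≤ p) :
    ∃ 𝓕 : Finset (Fin p → Fin p), (𝓕.card : ℝ) ≤ Real.exp (4 * (((p : ℝ) - q) * Real.log q)) ∧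
      (∀ F ∈ 𝓕, (Finset.univ.image F).card ≤ q) ∧
      ∀ {α : Type} (b : Fin p → α), (Set.range b).ncard ≤ q → ∃ F ∈ 𝓕, ∀ j, b (F j) = b j := by
  have hq1 : (1 : ℝ) ≤ q := by exact_mod_cast hq
  have hqp : (q : ℝ) ≤ p := by exact_mod_cast h
  have hlog : 0 ≤ Real.log q := Real.log_nonneg hq1
  rcases le_or_gt (2 * q) p with h2 | h2
  · obtain ⟨𝓕, hc, hF⟩ := exists_clusterMaps_of_two_mul_le hq h2
    refine ⟨𝓕, ?_, hF⟩
    have h2' : 2 * (q : ℝ) ≤ p := by exact_mod_cast h2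
    calc (𝓕.card : ℝ) ≤ (q : ℝ) ^ p := by exact_mod_cast hc
      _ = Real.exp (p * Real.log q) := by
        rw [Real.exp_nat_mul, Real.exp_log (by linarith)]
      _ ≤ _ := by
        apply Real.exp_le_exp.2
        nlinarith
  · obtain ⟨𝓕, hc, hF⟩ := exists_clusterMaps_of_le hq h
    refine ⟨𝓕, ?_, hF⟩
    have hp : (0 : ℝ) < p := by linarith
    calc (𝓕.card : ℝ) ≤ ((p : ℝ) * p) ^ (p - q) := by exact_mod_cast hc
      _ = Real.exp (((p - q : ℕ) : ℝ) * (2 * Real.log p)) := by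
        rw [Real.exp_nat_mul, two_mul, Real.exp_add, Real.exp_log hp]
      _ ≤ _ := by
        apply Real.exp_le_exp.2
        rw [Nat.cast_sub h]
        rcases eq_or_lt_of_le h with rfl | hlt
        · simp
        · have hpq : (p : ℝ) ≤ q ^ 2 := by
            have : p ≤ q ^ 2 := by nlinarith
            exact_mod_cast this
          have : Real.log p ≤ 2 * Real.log q := by
            have := Real.log_le_log hp hpq
            rwa [Real.log_pow] at this
          nlinarith [sub_nonneg.2 hqp]

/-! ### Row selection, column spaces and the net for feasible differences -/

/-- The `0`-`1` matrix whose left multiplication reindexes the rows along `F`. -/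
def rowSelect {p : ℕ} (F : Fin p → Fin p) : Matrix (Fin p) (Fin p) ℝ :=
  Matrix.of fun j k => if F j = k then 1 else 0

lemma rowSelect_mul {p m : ℕ} (F : Fin p → Fin p) (B : Matrix (Fin p) (Fin m) ℝ) (j : Fin p) :
    (rowSelect F * B) j = B (F j) := by
  ext l
  simp [rowSelect, Matrix.mul_apply]

lemma rank_rowSelect_le {p : ℕ} (F : Fin p → Fin p) :
    (rowSelect F).rank ≤ (Finset.univ.image F).card := by
  rw [Matrix.rank_eq_finrank_span_row]
  refine (finrank_span_le_card _).trans ?_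
  have : (Set.range (rowSelect F).row).toFinset ⊆
      (Finset.univ.image F).image fun k => (fun k' => if k = k' then (1 : ℝ) else 0) := by
    intro x hx
    obtain ⟨j, rfl⟩ := Set.mem_toFinset.1 hx
    exact Finset.mem_image.2 ⟨F j, Finset.mem_image_of_mem _ (Finset.mem_univ j), rfl⟩
  exact (Finset.card_le_card this).trans Finset.card_image_le

/-- The column space of a matrix. -/
abbrev colSpace {n p : ℕ} (A : Matrix (Fin n) (Fin p) ℝ) :
    Submodule ℝ (EuclideanSpace ℝ (Fin n)) :=
  Submodule.span ℝ (Set.range (colVec A))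

lemma colVec_mul_mem_colSpace {n p m : ℕ} (A : Matrix (Fin n) (Fin p) ℝ)
    (C : Matrix (Fin p) (Fin m) ℝ) (l : Fin m) : colVec (A * C) l ∈ colSpace A := by
  have : colVec (A * C) l = ∑ k, C k l • colVec A k := by
    ext i
    simp [colVec, Matrix.mul_apply, mul_comm]
  rw [this]
  exact Submodule.sum_mem _ fun k _ => Submodule.smul_mem _ _ (Submodule.subset_span ⟨k, rfl⟩)

lemma rank_add_le {n m : ℕ} (A B : Matrix (Fin n) (Fin m) ℝ) :
    (A + B).rank ≤ A.rank + B.rank := by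
  rw [← finrank_span_colVec A, ← finrank_span_colVec B, ← finrank_span_colVec (A + B)]
  refine le_trans (Submodule.finrank_mono (t := colSpace A ⊔ colSpace B) ?_)
    (Submodule.finrank_add_le_finrank_add_finrank _ _)
  refine Submodule.span_le.2 ?_
  rintro _ ⟨l, rfl⟩
  exact Submodule.add_mem_sup (S := colSpace A) (T := colSpace B)
    (Submodule.subset_span ⟨l, rfl⟩) (Submodule.subset_span ⟨l, rfl⟩)

lemma rank_sub_le {n m : ℕ} (A B : Matrix (Fin n) (Fin m) ℝ) :
    (A - B).rank ≤ A.rank + B.rank := by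
  have h : A - B = A + B * (-1 : Matrix (Fin m) (Fin m) ℝ) := by
    rw [Matrix.mul_neg, Matrix.mul_one, sub_eq_add_neg]
  rw [h]
  exact (rank_add_le _ _).trans (Nat.add_le_add_left (Matrix.rank_mul_le_left _ _) _)

/-- The differences `X B₁ - X B` over feasible `B₁`, measured against an arbitrary matrix, are
controlled by finitely many matrices in the unit ball. -/
lemma exists_feasible_net {n p m q r : ℕ} (X : Matrix (Fin n) (Fin p) ℝ) (hq : 1 ≤ q)
    (hqp : q ≤ p) {B : Matrix (Fin p) (Fin m) ℝ} (hB : B ∈ feasible p m q r) :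
    ∃ s : Finset (Matrix (Fin n) (Fin m) ℝ),
      (s.card : ℝ) ≤ Real.exp (8 * complexity m X q r) ∧ (∀ A ∈ s, frobSq A ≤ 1) ∧
      ∀ B₁ ∈ feasible p m q r, ∀ E : Matrix (Fin n) (Fin m) ℝ, ∃ A ∈ s,
        frobInner E (X * B₁ - X * B) ≤ 4 * √(frobSq (X * B₁ - X * B)) * frobInner E A := by
  classical
  obtain ⟨𝓕, hcard, hF, hcover⟩ := exists_clusterMaps hq hqp
  have hfac : ∀ B₁ ∈ feasible p m q r, ∃ F ∈ 𝓕, X * B₁ = X * rowSelect F * B₁ := by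
    intro B₁ hB₁
    obtain ⟨F, hF, hb⟩ := hcover (fun j => B₁ j) hB₁.2
    refine ⟨F, hF, ?_⟩
    have : rowSelect F * B₁ = B₁ := funext fun j => (rowSelect_mul F B₁ j).trans (hb j)
    rw [Matrix.mul_assoc, this]
  obtain ⟨F₀, hF₀, hBF₀⟩ := hfac B hB
  have hdim : ∀ F ∈ 𝓕, Module.finrank ℝ (colSpace (X * rowSelect F)) ≤ min q X.rank := by
    intro F hF'
    rw [finrank_span_colVec]
    exact le_min ((Matrix.rank_mul_le_right _ _).trans ((rank_rowSelect_le F).trans (hF F hF')))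
      (Matrix.rank_mul_le_left _ _)
  -- Since `B` is fixed, its pattern `F₀` is fixed too and only `F` is counted. Both summands have
  -- dimension at most `q ∧ rank X`.
  choose net hnet using fun F : Fin p → Fin p =>
    exists_lowRank_net (colSpace (X * rowSelect F) ⊔ colSpace (X * rowSelect F₀)) m (2 * r)
  refine ⟨𝓕.biUnion net, ?_, ?_, ?_⟩
  · have h5 : (5 : ℝ) ≤ Real.exp 2 := by
      have h1 := Real.exp_one_gt_d9
      have h2 : Real.exp 2 = Real.exp 1 * Real.exp 1 := by rw [← Real.exp_add]; norm_num
      nlinarith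
    have hN : (𝓕.biUnion net).card ≤ 𝓕.card * 5 ^ (2 * r * (2 * min q X.rank + m)) := by
      refine Finset.card_biUnion_le_card_mul _ _ _ fun F hF' => (hnet F).1.trans ?_
      refine Nat.pow_le_pow_right (by norm_num) (Nat.mul_le_mul_left _ (Nat.add_le_add_right ?_ _))
      refine (Submodule.finrank_add_le_finrank_add_finrank _ _).trans ?_
      have h1 := hdim F hF'
      have h2 := hdim F₀ hF₀
      omega
    calc ((𝓕.biUnion net).card : ℝ)
        ≤ 𝓕.card * (5 : ℝ) ^ (2 * r * (2 * min q X.rank + m)) := by exact_mod_cast hN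
      _ ≤ Real.exp (4 * (((p : ℝ) - q) * Real.log q)) *
          Real.exp 2 ^ (2 * r * (2 * min q X.rank + m)) := by gcongr
      _ ≤ _ := by
        rw [← Real.exp_nat_mul, ← Real.exp_add]
        apply Real.exp_le_exp.2
        have h1 : (0 : ℝ) ≤ ((p : ℝ) - q) * Real.log q :=
          mul_nonneg (sub_nonneg.2 (by exact_mod_cast hqp))
            (Real.log_nonneg (by exact_mod_cast hq))
        have h2 : (0 : ℝ) ≤ m * r := by positivity
        unfold complexity
        push_cast
        nlinarith
  · intro A hA
    obtain ⟨F, -, hA⟩ := Finset.mem_biUnion.1 hA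
    exact (hnet F).2.1 A hA
  · intro B₁ hB₁ E
    obtain ⟨F, hF', hBF⟩ := hfac B₁ hB₁
    obtain ⟨A, hA, hle⟩ := (hnet F).2.2 (X * B₁ - X * B) (by
        rw [← Matrix.mul_sub]
        refine (Matrix.rank_mul_le_right _ _).trans ((rank_sub_le _ _).trans ?_)
        have h1 := hB₁.1
        have h2 := hB.1
        omega) (fun l => by
        have h1 : colVec (X * B₁ - X * B) l = colVec (X * B₁) l - colVec (X * B) l := rfl
        rw [h1, hBF, hBF₀]
        exact Submodule.sub_mem_sup (colVec_mul_mem_colSpace _ _ _)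
          (colVec_mul_mem_colSpace _ _ _)) E
    exact ⟨A, Finset.mem_biUnion.2 ⟨F, hF', hA⟩, hle⟩

/-! ### Sub-Gaussian tails and maxima over finite sets -/

section SubGaussian

variable {Ω : Type*} [MeasurableSpace Ω] {P : Measure Ω}

/-- The infimum defining the norm need not be attained, hence the strict `σ < t`; this also covers
`σ = 0`. -/
lemma lintegral_exp_sq_le_two {Z : Ω → ℝ} {σ t : ℝ} (hσ : 0 ≤ σ)
    (h : psi2Norm P Z ≤ ENNReal.ofReal σ) (ht : σ < t) :
    ∫⁻ ω, ENNReal.ofReal (Real.exp ((Z ω / t) ^ 2)) ∂P ≤ 2 := by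
  have hlt : psi2Norm P Z < ENNReal.ofReal t :=
    h.trans_lt ((ENNReal.ofReal_lt_ofReal_iff (hσ.trans_lt ht)).2 ht)
  simp only [psi2Norm, iInf_lt_iff] at hlt
  obtain ⟨t', ht', hint, htt'⟩ := hlt
  have htt : t' < t := (ENNReal.ofReal_lt_ofReal_iff (hσ.trans_lt ht)).1 htt'
  refine (lintegral_mono fun ω => ENNReal.ofReal_le_ofReal (Real.exp_le_exp.2 ?_)).trans hint
  rw [div_pow, div_pow]
  gcongr

variable {n m : ℕ} {E : Ω → Matrix (Fin n) (Fin m) ℝ} {σ : ℝ}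

lemma SubGaussianMatrix.psi2Norm_le (hE : SubGaussianMatrix P E σ) (hσ : 0 ≤ σ)
    {A : Matrix (Fin n) (Fin m) ℝ} (hA : frobSq A ≤ 1) :
    psi2Norm P (fun ω => frobInner (E ω) A) ≤ ENNReal.ofReal σ := by
  refine (hE.2.2 A).trans (ENNReal.ofReal_le_ofReal ?_)
  have : √(frobSq A) ≤ 1 := Real.sqrt_le_one.2 hA
  nlinarith

lemma SubGaussianMatrix.aemeasurable (hE : SubGaussianMatrix P E σ)
    (A : Matrix (Fin n) (Fin m) ℝ) : AEMeasurable (fun ω => frobInner (E ω) A) P := by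
  unfold frobInner
  exact Finset.aemeasurable_fun_sum _ fun i _ => Finset.aemeasurable_fun_sum _ fun j _ =>
    (hE.1 i j).mul_const _

/-- The squares of finitely many linear functionals of a sub-Gaussian matrix have a common
majorant whose expectation is logarithmic in their number. -/
lemma SubGaussianMatrix.exists_majorant [IsProbabilityMeasure P] (hE : SubGaussianMatrix P E σ)
    (hσ : 0 ≤ σ) {s : Finset (Matrix (Fin n) (Fin m) ℝ)} (hs : ∀ A ∈ s, frobSq A ≤ 1) {K : ℝ}
    (hK : 0 ≤ K) (hcard : (s.card : ℝ) ≤ Real.exp K) {t : ℝ} (ht : σ < t) :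
    ∃ G : Ω → ℝ≥0∞, AEMeasurable G P ∧
      (∀ ω, ∀ A ∈ s, ENNReal.ofReal (frobInner (E ω) A ^ 2) ≤ G ω) ∧
      ∫⁻ ω, G ω ∂P ≤ ENNReal.ofReal (t ^ 2 * (K + 2)) := by
  have ht0 : 0 < t := hσ.trans_lt ht
  let e : Matrix (Fin n) (Fin m) ℝ → Ω → ℝ≥0∞ := fun A ω =>
    ENNReal.ofReal (Real.exp ((frobInner (E ω) A / t) ^ 2))
  have hem : ∀ A, AEMeasurable (e A) P := fun A =>
    ((Real.measurable_exp.comp_aemeasurable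
      (((hE.aemeasurable A).div_const t).pow_const 2))).ennreal_ofReal
  have hsum : AEMeasurable (fun ω => ∑ A ∈ s, e A ω) P :=
    Finset.aemeasurable_fun_sum _ fun A _ => hem A
  -- From `x ≤ K + exp (x - K)` with `x = (Z / t)²`, bounding one exponential by the sum of all; the
  -- factor `exp (-K)` cancels the cardinality.
  refine ⟨fun ω => ENNReal.ofReal (t ^ 2) *
    (ENNReal.ofReal K + ENNReal.ofReal (Real.exp (-K)) * ∑ A ∈ s, e A ω), ?_, ?_, ?_⟩
  · exact ((hsum.const_mul _).const_add _).const_mul _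
  · intro ω A hA
    have h1 : e A ω ≤ ∑ A ∈ s, e A ω := Finset.single_le_sum (f := fun A => e A ω)
      (fun _ _ => zero_le) hA
    refine le_trans ?_ (mul_le_mul_right (add_le_add_right (mul_le_mul_right h1 _) _) _)
    rw [← ENNReal.ofReal_mul (Real.exp_nonneg _), ← ENNReal.ofReal_add hK (by positivity),
      ← ENNReal.ofReal_mul (by positivity)]
    apply ENNReal.ofReal_le_ofReal
    rw [← Real.exp_add]
    have h2 := Real.add_one_le_exp (-K + (frobInner (E ω) A / t) ^ 2)
    have h3 : frobInner (E ω) A ^ 2 = t ^ 2 * (frobInner (E ω) A / t) ^ 2 := by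
      field_simp
    rw [h3]
    gcongr
    linarith
  · rw [lintegral_const_mul'' _ ((hsum.const_mul _).const_add _),
      lintegral_add_left' aemeasurable_const, lintegral_const_mul'' _ hsum,
      lintegral_finsetSum' _ fun A _ => hem A, ENNReal.ofReal_mul (by positivity)]
    gcongr
    rw [ENNReal.ofReal_add hK zero_le_two, lintegral_const, measure_univ, mul_one]
    gcongr
    calc ENNReal.ofReal (Real.exp (-K)) * ∑ A ∈ s, ∫⁻ ω, e A ω ∂P
        ≤ ENNReal.ofReal (Real.exp (-K)) * ∑ A ∈ s, 2 := by
          gcongr with A hA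
          exact lintegral_exp_sq_le_two hσ (hE.psi2Norm_le hσ (hs A hA)) ht
      _ = ENNReal.ofReal (Real.exp (-K) * (s.card * 2)) := by
          rw [Finset.sum_const, nsmul_eq_mul, ENNReal.ofReal_mul (Real.exp_nonneg _),
            ENNReal.ofReal_mul (by positivity)]
          simp
      _ ≤ ENNReal.ofReal 2 := by
          apply ENNReal.ofReal_le_ofReal
          rw [Real.exp_neg, inv_mul_le_iff₀ (Real.exp_pos K)]
          linarith

/-- Markov's inequality for `exp (Z² / (2σ)²)`. If `σ = 0`, letting the scale tend to `0` shows that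
the second moment vanishes, so `Z = 0` almost surely. -/
lemma SubGaussianMatrix.measure_sq_gt_le [IsProbabilityMeasure P]
    (hE : SubGaussianMatrix P E σ) (hσ : 0 ≤ σ) {A : Matrix (Fin n) (Fin m) ℝ}
    (hA : frobSq A ≤ 1) (u : ℝ) :
    P {ω | 4 * σ ^ 2 * u < frobInner (E ω) A ^ 2} ≤ ENNReal.ofReal (2 * Real.exp (-u)) := by
  rcases hσ.eq_or_lt with rfl | hpos
  · have h0 : ∫⁻ ω, ENNReal.ofReal (frobInner (E ω) A ^ 2) ∂P ≤ 0 := by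
      have hlim : Filter.Tendsto (fun t : ℝ => ENNReal.ofReal (t ^ 2 * (0 + 2)))
          (nhdsWithin 0 (Set.Ioi 0)) (nhds 0) := by
        have : Continuous fun t : ℝ => ENNReal.ofReal (t ^ 2 * (0 + 2)) :=
          ENNReal.continuous_ofReal.comp (by fun_prop)
        simpa using this.continuousWithinAt (s := Set.Ioi 0) (x := 0) |>.tendsto
      refine ge_of_tendsto hlim ?_
      filter_upwards [self_mem_nhdsWithin] with t ht
      obtain ⟨G, -, hG, hint⟩ := hE.exists_majorant (s := {A}) le_rfl (by simpa using hA) le_rfl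
        (by simp) ht
      exact (lintegral_mono fun ω => hG ω A (Finset.mem_singleton_self A)).trans hint
    have h1 := (lintegral_eq_zero_iff' ((hE.aemeasurable A).pow_const 2).ennreal_ofReal).1
      (le_antisymm h0 zero_le)
    have h2 : P {ω | 4 * (0 : ℝ) ^ 2 * u < frobInner (E ω) A ^ 2} = 0 := by
      refine measure_mono_null ?_ (ae_iff.1 h1)
      intro ω hω
      have : 0 < frobInner (E ω) A ^ 2 := by simpa using hω
      simpa using this.ne'
    rw [h2]
    exact zero_le
  · have hint := lintegral_exp_sq_le_two hσ (hE.psi2Norm_le hσ hA) (by linarith : σ < 2 * σ)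
    have hem : AEMeasurable (fun ω => ENNReal.ofReal
        (Real.exp ((frobInner (E ω) A / (2 * σ)) ^ 2))) P :=
      ((Real.measurable_exp.comp_aemeasurable
        (((hE.aemeasurable A).div_const _).pow_const 2))).ennreal_ofReal
    have hmk := (mul_meas_ge_le_lintegral₀ hem (ENNReal.ofReal (Real.exp u))).trans hint
    have hsub : {ω | 4 * σ ^ 2 * u < frobInner (E ω) A ^ 2} ⊆ {ω | ENNReal.ofReal (Real.exp u) ≤
        ENNReal.ofReal (Real.exp ((frobInner (E ω) A / (2 * σ)) ^ 2))} := by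
      intro ω hω
      apply ENNReal.ofReal_le_ofReal
      apply Real.exp_le_exp.2
      rw [div_pow, le_div_iff₀ (by positivity)]
      have : 4 * σ ^ 2 * u < frobInner (E ω) A ^ 2 := hω
      nlinarith
    refine (measure_mono hsub).trans ?_
    rw [mul_comm 2, Real.exp_neg, ENNReal.ofReal_mul (by positivity),
      ENNReal.ofReal_inv_of_pos (Real.exp_pos u), mul_comm, ← div_eq_mul_inv,
      ENNReal.le_div_iff_mul_le (Or.inl (by simp [Real.exp_pos])) (Or.inl ENNReal.ofReal_ne_top)]
    rw [mul_comm] at hmk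
    simpa using hmk

lemma SubGaussianMatrix.measure_exists_sq_gt_le [IsProbabilityMeasure P]
    (hE : SubGaussianMatrix P E σ) (hσ : 0 ≤ σ) {s : Finset (Matrix (Fin n) (Fin m) ℝ)}
    (hs : ∀ A ∈ s, frobSq A ≤ 1) {K : ℝ} (hcard : (s.card : ℝ) ≤ Real.exp K) (u : ℝ) :
    P {ω | ∃ A ∈ s, 4 * σ ^ 2 * u < frobInner (E ω) A ^ 2} ≤
      ENNReal.ofReal (2 * Real.exp (K - u)) := by
  have hset : {ω | ∃ A ∈ s, 4 * σ ^ 2 * u < frobInner (E ω) A ^ 2} =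
      ⋃ A ∈ s, {ω | 4 * σ ^ 2 * u < frobInner (E ω) A ^ 2} := by
    ext ω; simp
  rw [hset]
  calc _ ≤ ∑ A ∈ s, P {ω | 4 * σ ^ 2 * u < frobInner (E ω) A ^ 2} :=
        measure_biUnion_finset_le _ _
    _ ≤ ∑ A ∈ s, ENNReal.ofReal (2 * Real.exp (-u)) :=
        Finset.sum_le_sum fun A hA => hE.measure_sq_gt_le hσ (hs A hA) u
    _ = ENNReal.ofReal (s.card * (2 * Real.exp (-u))) := by
        rw [Finset.sum_const, nsmul_eq_mul, ENNReal.ofReal_mul (by positivity)]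
        simp
    _ ≤ _ := by
        apply ENNReal.ofReal_le_ofReal
        rw [sub_eq_add_neg, Real.exp_add]
        nlinarith [Real.exp_pos (-u)]

end SubGaussian

/-! ### Deterministic inequalities for the minimizer, the complexity and the clusters -/

section Deterministic

variable {n p m q r : ℕ} {μ : ℝ} {f : Matrix (Fin n) (Fin m) ℝ → ℝ}
  {X : Matrix (Fin n) (Fin p) ℝ}

lemma StronglyConvex.le_bregman (hf : StronglyConvex μ f) (α β : Matrix (Fin n) (Fin m) ℝ) :
    μ / 2 * frobSq (α - β) ≤ bregman f α β := by
  have := hf.2 β α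
  unfold bregman
  linarith

lemma StronglyConvex.bregman_nonneg (hf : StronglyConvex μ f) (hμ : 0 < μ)
    (α β : Matrix (Fin n) (Fin m) ℝ) : 0 ≤ bregman f α β :=
  le_trans (mul_nonneg (by linarith) (frobSq_nonneg _)) (hf.le_bregman α β)

lemma bregman_self (α : Matrix (Fin n) (Fin m) ℝ) : bregman f α α = 0 := by
  simp [bregman, frobInner]

lemma frobSq_sub_le (α β γ : Matrix (Fin n) (Fin m) ℝ) :
    frobSq (α - γ) ≤ 2 * frobSq (α - β) + 2 * frobSq (γ - β) := by
  simp only [frobSq, Finset.mul_sum, ← Finset.sum_add_distrib, Matrix.sub_apply]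
  refine Finset.sum_le_sum fun i _ => Finset.sum_le_sum fun j _ => ?_
  nlinarith [sq_nonneg (α i j - β i j + (γ i j - β i j))]

lemma IsGlobalCRL.bregman_le {Bhat B : Matrix (Fin p) (Fin m) ℝ}
    (hBhat : IsGlobalCRL X f q r Bhat) (hB : B ∈ feasible p m q r)
    (η : Matrix (Fin n) (Fin m) ℝ) :
    bregman f (X * Bhat) η ≤
      bregman f (X * B) η + frobInner (-grad f η) (X * Bhat - X * B) := by
  have h1 : f (X * Bhat) ≤ f (X * B) := hBhat.2 hB
  have h2 : frobInner (-grad f η) (X * Bhat - X * B) =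
      frobInner (grad f η) (X * B - η) - frobInner (grad f η) (X * Bhat - η) := by
    simp only [frobInner, ← Finset.sum_sub_distrib, Matrix.sub_apply, Matrix.neg_apply]
    refine Finset.sum_congr rfl fun i _ => Finset.sum_congr rfl fun j _ => ?_
    ring
  rw [h2]
  unfold bregman
  linarith

/-- Young's inequality splits `4 c Z` so that the `c²` part is at most half the sum of the two
Bregman errors; half the left side is then absorbed. -/
lemma IsGlobalCRL.bregman_le_of_net (hf : StronglyConvex μ f) (hμ : 0 < μ)
    {Bhat B : Matrix (Fin p) (Fin m) ℝ} (hBhat : IsGlobalCRL X f q r Bhat)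
    (hB : B ∈ feasible p m q r) (η A : Matrix (Fin n) (Fin m) ℝ)
    (hA : frobInner (-grad f η) (X * Bhat - X * B) ≤
      4 * √(frobSq (X * Bhat - X * B)) * frobInner (-grad f η) A) :
    bregman f (X * Bhat) η ≤
      3 * bregman f (X * B) η + 64 / μ * frobInner (-grad f η) A ^ 2 := by
  have h1 := hBhat.bregman_le hB η
  have h2 := frobSq_sub_le (X * Bhat) η (X * B)
  have h3 := hf.le_bregman (X * Bhat) η
  have h4 := hf.le_bregman (X * B) η
  set c := √(frobSq (X * Bhat - X * B)) with hc
  have hc2 : c ^ 2 = frobSq (X * Bhat - X * B) := Real.sq_sqrt (frobSq_nonneg _)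
  rw [← hc2] at h2
  set Z := frobInner (-grad f η) A
  have h5 : 4 * c * Z ≤ μ / 8 * c ^ 2 + 32 / μ * Z ^ 2 := by
    have h6 : μ / 8 * c ^ 2 + 32 / μ * Z ^ 2 - 4 * c * Z = (μ * c - 16 * Z) ^ 2 / (8 * μ) := by
      field_simp
      ring
    have h7 : 0 ≤ (μ * c - 16 * Z) ^ 2 / (8 * μ) := by positivity
    linarith
  have h8 : μ / 8 * c ^ 2 ≤
      (bregman f (X * Bhat) η + bregman f (X * B) η) / 2 := by nlinarith
  have h9 : 64 / μ * Z ^ 2 = 2 * (32 / μ * Z ^ 2) := by ring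
  linarith

/-- At `η = X B` the oracle error vanishes, so `μ c² / 2 ≤ 4 c Z`, and one factor `c` cancels. -/
lemma IsGlobalCRL.frobSq_le_of_net (hf : StronglyConvex μ f) (hμ : 0 < μ)
    {Bhat B : Matrix (Fin p) (Fin m) ℝ} (hBhat : IsGlobalCRL X f q r Bhat)
    (hB : B ∈ feasible p m q r) (A : Matrix (Fin n) (Fin m) ℝ)
    (hA : frobInner (-grad f (X * B)) (X * Bhat - X * B) ≤
      4 * √(frobSq (X * Bhat - X * B)) * frobInner (-grad f (X * B)) A) :
    frobSq (X * (Bhat - B)) ≤ 64 / μ ^ 2 * frobInner (-grad f (X * B)) A ^ 2 := by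
  have h1 := hBhat.bregman_le hB (X * B)
  rw [bregman_self] at h1
  have h3 := hf.le_bregman (X * Bhat) (X * B)
  rw [Matrix.mul_sub]
  set c := √(frobSq (X * Bhat - X * B)) with hc
  have hc2 : c ^ 2 = frobSq (X * Bhat - X * B) := Real.sq_sqrt (frobSq_nonneg _)
  have hc0 : 0 ≤ c := Real.sqrt_nonneg _
  rw [← hc2] at h3 ⊢
  set Z := frobInner (-grad f (X * B)) A
  rw [div_mul_eq_mul_div, le_div_iff₀ (by positivity)]
  have h4 : c * (μ * c) ≤ c * (8 * Z) := by nlinarith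
  rcases hc0.eq_or_lt with h0 | h0
  · rw [← h0]
    nlinarith [sq_nonneg Z]
  · have h5 := le_of_mul_le_mul_left h4 h0
    have h6 : 0 ≤ μ * c := by positivity
    nlinarith

lemma numRows_sub_le (A B : Matrix (Fin p) (Fin m) ℝ) :
    numRows (A - B) ≤ numRows A * numRows B := by
  unfold numRows
  rw [← Set.ncard_prod]
  refine le_trans (Set.ncard_le_ncard (t := (fun x : (Fin m → ℝ) × (Fin m → ℝ) => x.1 - x.2) ''
    ((Set.range fun j => A j) ×ˢ (Set.range fun j => B j))) ?_ (Set.toFinite _))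
    (Set.ncard_image_le (Set.toFinite _))
  rintro _ ⟨j, rfl⟩
  exact ⟨(A j, B j), ⟨⟨j, rfl⟩, ⟨j, rfl⟩⟩, rfl⟩

lemma numRows_le (B : Matrix (Fin p) (Fin m) ℝ) : numRows B ≤ p := by
  unfold numRows
  rw [← Set.image_univ]
  refine (Set.ncard_image_le (Set.toFinite _)).trans ?_
  simp

lemma rank_pos_of_one_lt_numRows {B : Matrix (Fin p) (Fin m) ℝ} (h : 1 < numRows B) :
    0 < B.rank := by
  by_contra! h0
  have h1 := finrank_span_colVec B
  rw [Nat.le_zero.1 h0, Submodule.finrank_eq_zero, Submodule.span_eq_bot] at h1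
  have hB : B = 0 := by
    ext j l
    have h2 := h1 (colVec B l) ⟨l, rfl⟩
    simpa [colVec] using congrArg (fun v : EuclideanSpace ℝ (Fin p) => v j) h2
  subst hB
  obtain ⟨a, ha, b, hb, hab⟩ := Set.one_lt_ncard_iff_nontrivial.1 h
  obtain ⟨j, rfl⟩ := ha
  obtain ⟨k, rfl⟩ := hb
  exact hab rfl

lemma complexity_nonneg (hq : 1 ≤ q) (hqp : q ≤ p) : 0 ≤ complexity m X q r := by
  have h1 : (0 : ℝ) ≤ ((p : ℝ) - q) * Real.log q :=
    mul_nonneg (sub_nonneg.2 (by exact_mod_cast hqp)) (Real.log_nonneg (by exact_mod_cast hq))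
  unfold complexity
  positivity

lemma half_le_log_of_one_lt (hq : 1 < q) : 1 / 2 ≤ Real.log q := by
  have h1 : Real.log 2 ≤ Real.log q := Real.log_le_log two_pos (by exact_mod_cast hq)
  have := Real.log_two_gt_d9
  linarith

/-- The rank term gains one factor `ϑ` from `q` and one from `r`. For the logarithm, `log ϑ ≤ ϑ - 1
≤ (ϑ² - 1) / 2 ≤ (ϑ² - 1) log q`, using `log q ≥ 1/2`. -/
lemma complexity_le_sq_mul {q' r' : ℕ} {ϑ : ℝ} (hϑ : 1 ≤ ϑ) (hq : 1 < q) (hqp : q' ≤ p)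
    (hr' : (r' : ℝ) = ϑ * r) (hq' : (q' : ℝ) = ϑ * q) :
    complexity m X q' r' ≤ ϑ ^ 2 * complexity m X q r := by
  have hlog := half_le_log_of_one_lt hq
  have hq0 : (0 : ℝ) < q := by exact_mod_cast hq.trans' one_pos
  have hqp' : (q' : ℝ) ≤ p := by exact_mod_cast hqp
  have hqq : (q : ℝ) ≤ q' := by rw [hq']; nlinarith
  have h1 : ((min q' X.rank : ℕ) : ℝ) ≤ ϑ * ((min q X.rank : ℕ) : ℝ) := by
    rw [Nat.cast_min, Nat.cast_min, hq', mul_min_of_nonneg _ _ (by linarith)]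
    refine min_le_min le_rfl ?_
    have : (0 : ℝ) ≤ X.rank := Nat.cast_nonneg _
    nlinarith
  have h2 : (((min q' X.rank : ℕ) : ℝ) + m) * r' ≤
      ϑ ^ 2 * ((((min q X.rank : ℕ) : ℝ) + m) * r) := by
    rw [hr']
    have hm : (m : ℝ) ≤ ϑ * m := le_mul_of_one_le_left (Nat.cast_nonneg _) hϑ
    calc _ ≤ (ϑ * ((min q X.rank : ℕ) : ℝ) + ϑ * m) * (ϑ * r) := by gcongr
      _ = _ := by ring
  have h3 : ((p : ℝ) - q') * Real.log q' ≤ ϑ ^ 2 * (((p : ℝ) - q) * Real.log q) := by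
    have h4 : Real.log q' ≤ ϑ ^ 2 * Real.log q := by
      rw [hq', Real.log_mul (by linarith) hq0.ne']
      have h5 := Real.log_le_sub_one_of_pos (by linarith : 0 < ϑ)
      nlinarith [sq_nonneg (ϑ - 1)]
    calc ((p : ℝ) - q') * Real.log q' ≤ ((p : ℝ) - q) * (ϑ ^ 2 * Real.log q) := by
          have : 0 ≤ ϑ ^ 2 * Real.log q := by positivity
          have : 0 ≤ (p : ℝ) - q := by linarith
          gcongr
      _ = _ := by ring
  unfold complexity
  linarith

/-- Lets the complexity pay for the probability `exp (-c (m + rank X))`. If `rank X` exceeds `q`,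
the excess is at most `p - q`, which the logarithmic term covers. -/
lemma half_add_rank_le_complexity (hq : 1 < q) (hqp : q ≤ p) (hr : 0 < r) :
    1 / 2 * ((m : ℝ) + X.rank) ≤ complexity m X q r := by
  have hlog := half_le_log_of_one_lt hq
  have hqp' : (q : ℝ) ≤ p := by exact_mod_cast hqp
  have hr1 : (1 : ℝ) ≤ r := by exact_mod_cast hr
  have hm : (0 : ℝ) ≤ m := Nat.cast_nonneg _
  have hX : (X.rank : ℝ) ≤ p := by
    have := X.rank_le_card_width
    rw [Fintype.card_fin] at this
    exact_mod_cast this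
  have hmin : (0 : ℝ) ≤ ((min q X.rank : ℕ) : ℝ) := Nat.cast_nonneg _
  have h1 : ((min q X.rank : ℕ) : ℝ) + m ≤ (((min q X.rank : ℕ) : ℝ) + m) * r :=
    le_mul_of_one_le_right (by positivity) hr1
  have h2 : ((p : ℝ) - q) * (1 / 2) ≤ ((p : ℝ) - q) * Real.log q :=
    mul_le_mul_of_nonneg_left hlog (by linarith)
  have h3 : (X.rank : ℝ) ≤ 2 * ((min q X.rank : ℕ) : ℝ) + ((p : ℝ) - q) := by
    rw [Nat.cast_min]
    rcases min_cases (q : ℝ) (X.rank : ℝ) with h | h <;> rw [h.1] <;> linarith [h.2,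
      Nat.cast_nonneg (α := ℝ) q, Nat.cast_nonneg (α := ℝ) X.rank]
  unfold complexity
  linarith

lemma sum_row_sq_le (A : Matrix (Fin p) (Fin m) ℝ) (j : Fin p) :
    ∑ l, A j l ^ 2 ≤ twoInfNorm A ^ 2 := by
  have h1 : √(∑ l, A j l ^ 2) ≤ twoInfNorm A :=
    le_ciSup (f := fun j => √(∑ l, A j l ^ 2)) (Set.toFinite _).bddAbove j
  calc ∑ l, A j l ^ 2 = √(∑ l, A j l ^ 2) ^ 2 :=
        (Real.sq_sqrt (Finset.sum_nonneg fun _ _ => sq_nonneg _)).symm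
    _ ≤ _ := by gcongr

/-- Rows of `B` that agree come from equal rows of `Bstar`, if `B` is close to `Bstar` and the
distinct rows of `Bstar` are well separated. -/
lemma row_eq_of_row_eq {B Bstar : Matrix (Fin p) (Fin m) ℝ} {R : ℝ}
    (hR : twoInfNorm (B - Bstar) ^ 2 ≤ R)
    (hsep : ∀ j k, Bstar j ≠ Bstar k → 4 * R < ∑ l, (Bstar j l - Bstar k l) ^ 2) {j k : Fin p}
    (h : B j = B k) : Bstar j = Bstar k := by
  by_contra hne
  have h1 := hsep j k hne
  have hj := (sum_row_sq_le (B - Bstar) j).trans hR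
  have hk := (sum_row_sq_le (B - Bstar) k).trans hR
  have h2 : ∑ l, (Bstar j l - Bstar k l) ^ 2 ≤
      2 * ∑ l, (B - Bstar) j l ^ 2 + 2 * ∑ l, (B - Bstar) k l ^ 2 := by
    simp only [Finset.mul_sum, ← Finset.sum_add_distrib, Matrix.sub_apply]
    refine Finset.sum_le_sum fun l _ => ?_
    rw [h]
    nlinarith [sq_nonneg (B k l - Bstar j l + (B k l - Bstar k l))]
  linarith

/-- Refinement induces a surjection from the distinct rows of `B` onto those of `Bstar`; the
cardinality bound makes it injective. -/
lemma row_eq_of_numRows_le {B Bstar : Matrix (Fin p) (Fin m) ℝ}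
    (href : ∀ j k, B j = B k → Bstar j = Bstar k) (hcard : numRows B ≤ numRows Bstar)
    {j k : Fin p} (h : Bstar j = Bstar k) : B j = B k := by
  let g : (Set.range fun j => B j) → (Set.range fun j => Bstar j) :=
    fun x => ⟨Bstar x.2.choose, x.2.choose, rfl⟩
  have hg : ∀ j, g ⟨B j, j, rfl⟩ = ⟨Bstar j, j, rfl⟩ := fun j => by
    have hex : ∃ k, B k = B j := ⟨j, rfl⟩
    exact Subtype.ext (href _ _ hex.choose_spec)
  have hsurj : Function.Surjective g := by
    rintro ⟨_, j, rfl⟩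
    exact ⟨⟨B j, j, rfl⟩, hg j⟩
  have hinj : Function.Injective g :=
    (hsurj.bijective_of_nat_card_le hcard).1
  have h1 : g ⟨B j, j, rfl⟩ = g ⟨B k, k, rfl⟩ := by
    rw [hg, hg]
    exact Subtype.ext h
  exact congrArg Subtype.val (hinj h1)

end Deterministic

/-! ### Expectation and high-probability bounds -/

section Probabilistic

variable {n p m : ℕ} {X : Matrix (Fin n) (Fin p) ℝ} {Bstar : Matrix (Fin p) (Fin m) ℝ}
  {Ω : Type*} [MeasurableSpace Ω] {P : Measure Ω} [IsProbabilityMeasure P]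
  {f : Ω → Matrix (Fin n) (Fin m) ℝ → ℝ} {μ σ : ℝ} {q r : ℕ}
  {Bhat : Ω → Matrix (Fin p) (Fin m) ℝ}

/-- The oracle inequality for the expected Bregman error of a global minimizer. -/
theorem lintegral_bregman_le (hμ : 0 < μ) (hσ : 0 ≤ σ) (hq : 1 ≤ q) (hqp : q ≤ p)
    (hf : ∀ ω, StronglyConvex μ (f ω))
    (hE : SubGaussianMatrix P (fun ω => -grad (f ω) (X * Bstar)) σ)
    (hBhat : ∀ᵐ ω ∂P, IsGlobalCRL X (f ω) q r (Bhat ω)) {B : Matrix (Fin p) (Fin m) ℝ}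
    (hB : B ∈ feasible p m q r) :
    ∫⁻ ω, ENNReal.ofReal (bregman (f ω) (X * Bhat ω) (X * Bstar)) ∂P ≤
      ENNReal.ofReal 512 *
        (∫⁻ ω, ENNReal.ofReal (bregman (f ω) (X * B) (X * Bstar)) ∂P +
          ENNReal.ofReal (σ ^ 2 / μ * (complexity m X q r + 1))) := by
  have hK : 0 ≤ complexity m X q r := complexity_nonneg hq hqp
  obtain ⟨s, hcard, hs, hnet⟩ := exists_feasible_net X hq hqp hB
  set I := ∫⁻ ω, ENNReal.ofReal (bregman (f ω) (X * B) (X * Bstar)) ∂P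
  have hbound : ∀ t, σ < t →
      ∫⁻ ω, ENNReal.ofReal (bregman (f ω) (X * Bhat ω) (X * Bstar)) ∂P ≤
        ENNReal.ofReal 3 * I +
          ENNReal.ofReal (64 / μ * (t ^ 2 * (8 * complexity m X q r + 2))) := by
    intro t ht
    obtain ⟨G, hGm, hG, hint⟩ := hE.exists_majorant hσ hs (by positivity) hcard ht
    calc ∫⁻ ω, ENNReal.ofReal (bregman (f ω) (X * Bhat ω) (X * Bstar)) ∂P
        ≤ ∫⁻ ω, ENNReal.ofReal 3 * ENNReal.ofReal (bregman (f ω) (X * B) (X * Bstar)) +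
            ENNReal.ofReal (64 / μ) * G ω ∂P := by
          refine lintegral_mono_ae ?_
          filter_upwards [hBhat] with ω hω
          obtain ⟨A, hA, hle⟩ := hnet _ hω.1 (-grad (f ω) (X * Bstar))
          refine (ENNReal.ofReal_le_ofReal
            (hω.bregman_le_of_net (hf ω) hμ hB _ A hle)).trans ?_
          rw [ENNReal.ofReal_add (mul_nonneg zero_le_three ((hf ω).bregman_nonneg hμ _ _))
            (by positivity), ENNReal.ofReal_mul zero_le_three,
            ENNReal.ofReal_mul (p := 64 / μ) (by positivity)]
          gcongr
          exact hG ω A hA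
      _ = ENNReal.ofReal 3 * I + ENNReal.ofReal (64 / μ) * ∫⁻ ω, G ω ∂P := by
          rw [lintegral_add_right' _ (hGm.const_mul _),
            lintegral_const_mul' _ _ ENNReal.ofReal_ne_top,
            lintegral_const_mul' _ _ ENNReal.ofReal_ne_top]
      _ ≤ _ := by
          rw [ENNReal.ofReal_mul (p := 64 / μ) (by positivity)]
          gcongr
  -- The bound holds for every `t > σ`; letting `t` decrease to `σ` gives it at `σ`.
  have hlim : Filter.Tendsto (fun t : ℝ => ENNReal.ofReal 3 * I +
      ENNReal.ofReal (64 / μ * (t ^ 2 * (8 * complexity m X q r + 2))))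
      (nhdsWithin σ (Set.Ioi σ)) (nhds (ENNReal.ofReal 3 * I +
        ENNReal.ofReal (64 / μ * (σ ^ 2 * (8 * complexity m X q r + 2))))) := by
    have : Continuous fun t : ℝ =>
        ENNReal.ofReal (64 / μ * (t ^ 2 * (8 * complexity m X q r + 2))) :=
      ENNReal.continuous_ofReal.comp (by fun_prop)
    exact tendsto_const_nhds.add (this.continuousWithinAt (s := Set.Ioi σ) (x := σ)).tendsto
  have h1 := ge_of_tendsto hlim (Filter.eventually_of_mem self_mem_nhdsWithin hbound)
  refine h1.trans ?_
  rw [mul_add (ENNReal.ofReal 512), ← ENNReal.ofReal_mul (by norm_num)]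
  refine add_le_add ?_ (ENNReal.ofReal_le_ofReal ?_)
  · gcongr
    norm_num
  · have h2 : 0 ≤ σ ^ 2 / μ := by positivity
    have h3 : 64 / μ * (σ ^ 2 * (8 * complexity m X q r + 2)) =
        64 * (σ ^ 2 / μ * (8 * complexity m X q r + 2)) := by ring
    rw [h3]
    nlinarith

/-- The high-probability bound for the row-wise estimation error of a global minimizer. -/
theorem measure_bad_event_le (hμ : 0 < μ) (hσ : 0 ≤ σ) (hq : 1 ≤ q) (hqp : q ≤ p)
    (hf : ∀ ω, StronglyConvex μ (f ω))
    (hE : SubGaussianMatrix P (fun ω => -grad (f ω) (X * Bstar)) σ)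
    (hBhat : ∀ᵐ ω ∂P, IsGlobalCRL X (f ω) q r (Bhat ω)) {ϑ δ : ℝ} (hϑ : 1 ≤ ϑ) (hδ : 0 < δ)
    (hqs : 1 < numRows Bstar) (hr : (r : ℝ) = ϑ * Bstar.rank)
    (hq' : (q : ℝ) = ϑ * numRows Bstar)
    (hX : ∀ B : Matrix (Fin p) (Fin m) ℝ, (B.rank : ℝ) ≤ (1 + ϑ) * Bstar.rank →
      (numRows B : ℝ) ≤ ϑ * (numRows Bstar : ℝ) ^ 2 →
      δ * twoInfNorm B ^ 2 ≤ frobSq (X * B) / n) :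
    P {ω | ¬ (IsGlobalCRL X (f ω) q r (Bhat ω) ∧
        twoInfNorm (Bhat ω - Bstar) ^ 2 ≤ estBound X Bstar 2304 ϑ σ δ μ)} ≤
      ENNReal.ofReal (2 * Real.exp (-(1 / 2) * (m + X.rank))) := by
  have hfeas : Bstar ∈ feasible p m q r := by
    constructor
    · have : (Bstar.rank : ℝ) ≤ r := hr ▸ le_mul_of_one_le_left (Nat.cast_nonneg _) hϑ
      exact_mod_cast this
    · have : (numRows Bstar : ℝ) ≤ q := hq' ▸ le_mul_of_one_le_left (Nat.cast_nonneg _) hϑ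
      exact_mod_cast this
  obtain ⟨s, hcard, hs, hnet⟩ := exists_feasible_net X hq hqp hfeas
  have hK := complexity_le_sq_mul (m := m) (X := X) hϑ hqs hqp hr hq'
  have hKs := half_add_rank_le_complexity (m := m) (X := X) hqs (numRows_le Bstar)
    (rank_pos_of_one_lt_numRows hqs)
  set κ := complexity m X (numRows Bstar) Bstar.rank
  have hκ : 0 ≤ κ := le_trans (by positivity) hKs
  -- The net costs at most `8 ϑ² κ` in the exponent; the level `9 ϑ² κ` leaves `-ϑ² κ ≤ -κ`. The
  -- constant `2304` is `64 · 4 · 9`.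
  have htail := hE.measure_exists_sq_gt_le hσ hs hcard (9 * (ϑ ^ 2 * κ))
  refine (measure_mono_ae ?_).trans (htail.trans (ENNReal.ofReal_le_ofReal ?_))
  · filter_upwards [hBhat] with ω hω hbad
    by_contra hgood
    refine hbad ⟨hω, ?_⟩
    have hsmall : ∀ A ∈ s, frobInner (-grad (f ω) (X * Bstar)) A ^ 2 ≤
        4 * σ ^ 2 * (9 * (ϑ ^ 2 * κ)) := fun A hA => by
      by_contra! hlt
      exact hgood ⟨A, hA, hlt⟩
    obtain ⟨A, hA, hle⟩ := hnet _ hω.1 (-grad (f ω) (X * Bstar))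
    have h1 := hω.frobSq_le_of_net (hf ω) hμ hfeas A hle
    -- The error has rank at most `r + r* = (1 + ϑ) r*` and at most `q q* = ϑ q*²` distinct rows, so
    -- the eigenvalue condition applies.
    have h2 := hX (Bhat ω - Bstar) (by
        have h3 : ((Bhat ω - Bstar).rank : ℝ) ≤ r + Bstar.rank := by
          exact_mod_cast (rank_sub_le _ _).trans (Nat.add_le_add_right hω.1.1 _)
        linarith) (by
        have h3 : (numRows (Bhat ω - Bstar) : ℝ) ≤ q * numRows Bstar := by
          exact_mod_cast (numRows_sub_le _ _).trans (Nat.mul_le_mul_right _ hω.1.2)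
        rw [hq'] at h3
        linarith)
    calc twoInfNorm (Bhat ω - Bstar) ^ 2 ≤ frobSq (X * (Bhat ω - Bstar)) / n / δ := by
          rwa [le_div_iff₀ hδ, mul_comm]
      _ ≤ (64 / μ ^ 2 * (4 * σ ^ 2 * (9 * (ϑ ^ 2 * κ)))) / n / δ := by
          have := hsmall A hA
          have h5 : frobSq (X * (Bhat ω - Bstar)) ≤
              64 / μ ^ 2 * (4 * σ ^ 2 * (9 * (ϑ ^ 2 * κ))) := h1.trans (by gcongr)
          gcongr
      _ = estBound X Bstar 2304 ϑ σ δ μ := by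
          rw [estBound, div_div]
          simp only [div_eq_mul_inv, mul_inv]
          ring
  · gcongr
    nlinarith [one_le_pow₀ hϑ (n := 2)]

/-- Only subadditivity of the outer measure is used, so neither event has to be measurable. -/
lemma one_sub_le_real_of_measure_compl_le {S T : Set Ω} {x : ℝ} (hx : 0 ≤ x)
    (hS : P {ω | ω ∉ S} ≤ ENNReal.ofReal x) (hST : S ⊆ T) : 1 - x ≤ P.real T := by
  have h1 : (1 : ℝ≥0∞) ≤ P T + P {ω | ω ∉ S} := by
    rw [← measure_univ (μ := P)]
    refine (measure_mono fun ω _ => ?_).trans (measure_union_le _ _)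
    by_cases h : ω ∈ S
    exacts [Or.inl (hST h), Or.inr h]
  have h2 : (1 : ℝ≥0∞) ≤ ENNReal.ofReal (P.real T + x) := by
    rw [ENNReal.ofReal_add measureReal_nonneg hx, ofReal_measureReal]
    exact h1.trans (by gcongr)
  have h3 := ENNReal.one_le_ofReal.1 h2
  linarith

end Probabilistic

end CRL

theorem corollary1 :
    ∃ C₁ c₀ c C : ℝ, 0 < C₁ ∧ 0 < c₀ ∧ 0 < c ∧ 0 < C ∧
    ∀ (n p m : ℕ) (X : Matrix (Fin n) (Fin p) ℝ) (Bstar : Matrix (Fin p) (Fin m) ℝ)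
      (Ω : Type u) [MeasurableSpace Ω] (P : Measure Ω) [IsProbabilityMeasure P]
      (𝒴 : Type v) [MeasurableSpace 𝒴] (Y : Ω → 𝒴) (l₀ : Matrix (Fin n) (Fin m) ℝ → 𝒴 → ℝ)
      (μ σ : ℝ) (q r : ℕ) (Bhat : Ω → Matrix (Fin p) (Fin m) ℝ),
      Measurable Y → (∀ η, Measurable (l₀ η)) → (∀ j l, Measurable fun ω => Bhat ω j l) →
      0 < μ → 0 ≤ σ → 1 ≤ q → q ≤ p →
      (∀ y, StronglyConvex μ fun η => l₀ η y) →
      SubGaussianMatrix P (fun ω => -grad (fun η => l₀ η (Y ω)) (X * Bstar)) σ →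
      (∀ᵐ ω ∂P, IsGlobalCRL X (fun η => l₀ η (Y ω)) q r (Bhat ω)) →
      -- oracle inequality
      (∀ B ∈ feasible p m q r,
        ∫⁻ ω, ENNReal.ofReal (bregman (fun η => l₀ η (Y ω)) (X * Bhat ω) (X * Bstar)) ∂P ≤
          ENNReal.ofReal C₁ *
            (∫⁻ ω, ENNReal.ofReal (bregman (fun η => l₀ η (Y ω)) (X * B) (X * Bstar)) ∂P +
              ENNReal.ofReal (σ ^ 2 / μ * (complexity m X q r + 1)))) ∧
      -- estimation error and cluster recovery
      (∀ ϑ δ : ℝ, 1 ≤ ϑ → 0 < δ → 1 < numRows Bstar →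
        (r : ℝ) = ϑ * Bstar.rank → (q : ℝ) = ϑ * numRows Bstar →
        (∀ B : Matrix (Fin p) (Fin m) ℝ, (B.rank : ℝ) ≤ (1 + ϑ) * Bstar.rank →
          (numRows B : ℝ) ≤ ϑ * (numRows Bstar : ℝ) ^ 2 →
          δ * twoInfNorm B ^ 2 ≤ frobSq (X * B) / n) →
        1 - C * Real.exp (-c * (m + X.rank)) ≤
            P.real {ω | twoInfNorm (Bhat ω - Bstar) ^ 2 ≤ estBound X Bstar c₀ ϑ σ δ μ} ∧
        ((∀ j k, Bstar j ≠ Bstar k →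
            4 * estBound X Bstar c₀ ϑ σ δ μ < ∑ l, (Bstar j l - Bstar k l) ^ 2) →
          1 - C * Real.exp (-c * (m + X.rank)) ≤
            P.real {ω | (∀ j k, Bhat ω j = Bhat ω k → Bstar j = Bstar k) ∧
              (q = numRows Bstar → ∀ j k, Bhat ω j = Bhat ω k ↔ Bstar j = Bstar k)})) := by
  refine ⟨512, 2304, 1 / 2, 2, by norm_num, by norm_num, by norm_num, by norm_num, ?_⟩
  intro n p m X Bstar Ω _ P _ 𝒴 _ Y l₀ μ σ q r Bhat _ _ _ hμ hσ hq hqp hconv hE hBhat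
  have hf : ∀ ω, StronglyConvex μ fun η => l₀ η (Y ω) := fun ω => hconv (Y ω)
  refine ⟨fun B hB => lintegral_bregman_le hμ hσ hq hqp hf hE hBhat hB, ?_⟩
  intro ϑ δ hϑ hδ hqs hr hq' hX
  have hbad := measure_bad_event_le hμ hσ hq hqp hf hE hBhat hϑ hδ hqs hr hq' hX
  refine ⟨one_sub_le_real_of_measure_compl_le (by positivity) hbad fun ω hω => hω.2,
    fun hsep => one_sub_le_real_of_measure_compl_le (by positivity) hbad fun ω hω => ?_⟩
  have href : ∀ j k, Bhat ω j = Bhat ω k → Bstar j = Bstar k :=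
    fun j k => row_eq_of_row_eq hω.2 hsep
  exact ⟨href, fun hqq j k => ⟨href j k, row_eq_of_numRows_le href (hω.1.1.2.trans hqq.le)⟩⟩
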